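/- Let $\mathcal{A}=(\mathcal{A},\mathbb{E},\mathfrak{s})$ be a Krull–Schmidt extriangulated category (in the sense of Nakaoka–Palu); subcategories are full, additive and closed under isomorphisms. A \emph{semibrick} is a set $\mathcal{X}$ of isomorphism classes of objects whose endomorphism rings are division rings, such that $\mathrm{Hom}(X_1,X_2)=0$ for non-isomorphic $X_1,X_2\in\mathcal{X}$. $\mathrm{Filt}(\mathcal{X})$ is the subcategory of objects $M$ that admit a filtration $0=M_0\to M_1\to\cdots\to M_n=M$ by inflations with cones in $\mathcal{X}$, and $l_{\mathcal{X}}(M)$ is the minimal such $n$. Let $\mathcal{C}\subseteq\mathcal{A}$ be an extension-closed subcategory; its $\mathbb{E}$-triangles are the $\mathbb{E}$-triangles of $\mathcal{A}$ with all terms in $\mathcal{C}$. A \emph{length function} on $\mathcal{C}$ is a map $\Theta$ from isomorphism classes of objects of $\mathcal{C}$ to $\mathbb{N}$ such that $\Theta(X)=0$ iff $X\cong 0$, and $\Theta(L)\le\Theta(X)+\Theta(M)$ for every $\mathbb{E}$-triangle $X\to L\to M\overset{\delta}{\dashrightarrow}$ in $\mathcal{C}$, with equality if $\delta=0$. Such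 a triangle is \emph{$\Theta$-stable} if equality holds; its first and second morphisms are then called a $\Theta$-inflation and a $\Theta$-deflation. Let $\Theta_1$ be the class of non-zero objects of $\mathcal{C}$ of minimal $\Theta$; for $n\ge 2$ let $\Theta_n$ be the union of $\Theta_{n-1}$ and the class of objects $M$ of $\mathcal{C}$ with $\Theta(M)=n$ that have no non-zero morphism from or to an object of $\Theta_{n-1}$; and let $\Theta_\infty=\bigcup_{n\ge1}\Theta_n$. The pair $(\mathcal{C},\Theta)$ is a \emph{length wide subcategory} if $\Theta$ is a length function with $\Theta(M)=1$ for all $M\in\Theta_1$, every morphism of $\mathcal{C}$ is a $\Theta$-deflation followed by a $\Theta$-inflation, and $\Theta_1=\Theta_\infty$. Let $\mathrm{sim}(\mathcal{C})$ be the set of isomorphism classes of non-zero objects $M$ of $\mathcal{C}$ for which there is no $\Theta$-stable $\mathbb{E}$-triangle $A\to M\to B\dashrightarrow$ in $\mathcal{C}$ with $A,B\neq0$. Theorem. The assignments $$\mathcal{X}\mapsto(\mathrm{Filt}(\mathcal{X}),l_{\mathcal{X}}),\qquad (\mathcal{C},\Theta)\mapsto\mathrm{sim}(\mathcal{C})$$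 are mutually inverse bijections between the semibricks in $\mathcal{A}$ and the length wide subcategories $(\mathcal{C},\Theta)$ in $\mathcal{A}$. -/

import Mathlib

open CategoryTheory CategoryTheory.Limits Opposite

universe w v u

namespace Extri

section Extension

variable {C : Type u} [Category.{v} C] (E : Cᵒᵖ ⥤ C ⥤ AddCommGrpCat.{w})

/-- The abelian group `𝔼(Z, X)` of extensions of `Z` by `X`. -/
abbrev Ext (Z X : C) : Type w := (E.obj (op Z)).obj X

variable {E}

/-- `a_* δ = 𝔼(Z, a)(δ)`. -/
def push {Z X X' : C} (a : X ⟶ X') (δ : Ext E Z X) : Ext E Z X' :=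
  ((E.obj (op Z)).map a).hom δ

/-- `c^* δ = 𝔼(c, X)(δ)`. -/
def pull {Z Z' X : C} (c : Z' ⟶ Z) (δ : Ext E Z X) : Ext E Z' X :=
  ((E.map c.op).app X).hom δ

/-- The direct sum `δ ⊕ δ'` of two extensions: the element of `𝔼(Z ⊞ Z', X ⊞ X')` with
components `(δ, 0, 0, δ')`. -/
noncomputable def extSum [Preadditive C] [HasBinaryBiproducts C] {Z X Z' X' : C}
    (δ : Ext E Z X) (δ' : Ext E Z' X') : Ext E (Z ⊞ Z') (X ⊞ X') :=
  push biprod.inl (pull biprod.fst δ) + push biprod.inr (pull biprod.snd δ')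

end Extension

section Sequences

variable {C : Type u} [Category.{v} C]

/-- A sequence `X ⟶ Y ⟶ Z` with fixed end terms. -/
structure Seq (X Z : C) where
  mid : C
  f : X ⟶ mid
  g : mid ⟶ Z

/-- Two sequences with the same end terms are equivalent if there is an isomorphism of the middle
terms that is compatible with the identities of the end terms. -/
instance seqSetoid (X Z : C) : Setoid (Seq X Z) where
  r S T := ∃ h : S.mid ≅ T.mid, S.f ≫ h.hom = T.f ∧ h.hom ≫ T.g = S.g
  iseqv :=
    { refl := fun S => ⟨Iso.refl _, by simp, by simp⟩
      symm := by
        rintro S T ⟨h, h₁, h₂⟩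
        exact ⟨h.symm, by simp [← h₁], by simp [← h₂]⟩
      trans := by
        rintro S T U ⟨h, h₁, h₂⟩ ⟨k, k₁, k₂⟩
        exact ⟨h ≪≫ k, by simp [← k₁, ← h₁], by simp [k₂, h₂]⟩ }

end Sequences

section Structure

variable (C : Type u) [Category.{v} C] [Preadditive C] [HasZeroObject C] [HasBinaryBiproducts C]

/-- An extriangulated structure `(𝔼, 𝔰)` on an additive category, in the sense of Nakaoka and
Palu. The field `s` is the correspondence `𝔰`, and an equation `s δ = ⟦⟨B, x, y⟩⟧` says that
`A --x--> B --y--> D` realizes `δ ∈ 𝔼(D, A)`. -/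
structure ExtriangulatedStructure where
  /-- the bifunctor `𝔼` -/
  E : Cᵒᵖ ⥤ C ⥤ AddCommGrpCat.{w}
  /-- (ET1): `𝔼` is additive in the covariant variable -/
  additive_right : ∀ Z : Cᵒᵖ, (E.obj Z).Additive
  /-- (ET1): `𝔼` is additive in the contravariant variable -/
  additive_left : ∀ X : C, (E.flip.obj X).Additive
  /-- the correspondence `𝔰` -/
  s : ∀ {D A : C}, Ext E D A → Quotient (seqSetoid A D)
  /-- (ET2): `𝔰` is a realization of `𝔼` -/
  realization : ∀ {A B D A' B' D' : C} {x : A ⟶ B} {y : B ⟶ D} {x' : A' ⟶ B'} {y' : B' ⟶ D'}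
    {δ : Ext E D A} {δ' : Ext E D' A'}, s δ = ⟦⟨B, x, y⟩⟧ → s δ' = ⟦⟨B', x', y'⟩⟧ →
    ∀ (a : A ⟶ A') (c : D ⟶ D'), push a δ = pull c δ' →
      ∃ b : B ⟶ B', x ≫ b = a ≫ x' ∧ y ≫ c = b ≫ y'
  /-- (ET2): the realization is additive, zero extensions -/
  realization_zero : ∀ (A D : C),
    s (0 : Ext E D A) = ⟦⟨A ⊞ D, biprod.inl, biprod.snd⟩⟧
  /-- (ET2): the realization is additive, direct sums -/
  realization_sum : ∀ {A B D A' B' D' : C} {x : A ⟶ B} {y : B ⟶ D} {x' : A' ⟶ B'}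
    {y' : B' ⟶ D'} {δ : Ext E D A} {δ' : Ext E D' A'}, s δ = ⟦⟨B, x, y⟩⟧ →
    s δ' = ⟦⟨B', x', y'⟩⟧ →
      s (extSum δ δ') = ⟦⟨B ⊞ B', biprod.map x x', biprod.map y y'⟩⟧
  /-- (ET3) -/
  et3 : ∀ {A B D A' B' D' : C} {x : A ⟶ B} {y : B ⟶ D} {x' : A' ⟶ B'} {y' : B' ⟶ D'}
    {δ : Ext E D A} {δ' : Ext E D' A'}, s δ = ⟦⟨B, x, y⟩⟧ → s δ' = ⟦⟨B', x', y'⟩⟧ →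
    ∀ (a : A ⟶ A') (b : B ⟶ B'), x ≫ b = a ≫ x' →
      ∃ c : D ⟶ D', y ≫ c = b ≫ y' ∧ push a δ = pull c δ'
  /-- (ET3)ᵒᵖ -/
  et3op : ∀ {A B D A' B' D' : C} {x : A ⟶ B} {y : B ⟶ D} {x' : A' ⟶ B'} {y' : B' ⟶ D'}
    {δ : Ext E D A} {δ' : Ext E D' A'}, s δ = ⟦⟨B, x, y⟩⟧ → s δ' = ⟦⟨B', x', y'⟩⟧ →
    ∀ (b : B ⟶ B') (c : D ⟶ D'), y ≫ c = b ≫ y' →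
      ∃ a : A ⟶ A', x ≫ b = a ≫ x' ∧ push a δ = pull c δ'
  /-- (ET4) -/
  et4 : ∀ {A B D M F : C} {f : A ⟶ B} {f' : B ⟶ D} {g : B ⟶ M} {g' : M ⟶ F}
    {δ : Ext E D A} {δ' : Ext E F B}, s δ = ⟦⟨B, f, f'⟩⟧ → s δ' = ⟦⟨M, g, g'⟩⟧ →
      ∃ (N : C) (d : D ⟶ N) (e : N ⟶ F) (h' : M ⟶ N) (δ'' : Ext E N A),
        s δ'' = ⟦⟨M, f ≫ g, h'⟩⟧ ∧ g ≫ h' = f' ≫ d ∧ h' ≫ e = g' ∧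
        s (push f' δ') = ⟦⟨N, d, e⟩⟧ ∧ pull d δ'' = δ ∧ push f δ'' = pull e δ'
  /-- (ET4)ᵒᵖ -/
  et4op : ∀ {A B D M F : C} {f' : D ⟶ A} {f : A ⟶ B} {g' : F ⟶ B} {g : B ⟶ M}
    {δ : Ext E B D} {δ' : Ext E M F}, s δ = ⟦⟨A, f', f⟩⟧ → s δ' = ⟦⟨B, g', g⟩⟧ →
      ∃ (N : C) (d : D ⟶ N) (e : N ⟶ F) (h' : N ⟶ A) (δ'' : Ext E M N),
        s δ'' = ⟦⟨A, h', f ≫ g⟩⟧ ∧ h' ≫ f = e ≫ g' ∧ d ≫ h' = f' ∧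
        s (pull g' δ) = ⟦⟨N, d, e⟩⟧ ∧ push e δ'' = δ' ∧ pull g δ'' = push d δ

/-- An additive category is Krull-Schmidt if every object is a finite direct sum of objects with
local endomorphism rings. -/
def IsKrullSchmidt : Prop :=
  ∀ M : C, ∃ (n : ℕ) (X : Fin n → C) (b : Bicone X),
    Nonempty b.IsBilimit ∧ Nonempty (b.pt ≅ M) ∧ ∀ i, IsLocalRing (End (X i))

end Structure

variable {C : Type u} [Category.{v} C] [Preadditive C] [HasZeroObject C] [HasBinaryBiproducts C]

/-- The endomorphism ring of `M` is a division ring. -/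
def IsBrick (M : C) : Prop :=
  Nontrivial (End M) ∧ ∀ f : End M, f ≠ 0 → IsUnit f

/-- A semibrick. A set of isomorphism classes of objects is given by the corresponding
isomorphism-closed property of objects. -/
structure IsSemibrick (X : ObjectProperty C) : Prop where
  iso_closed : X.IsClosedUnderIsomorphisms
  brick : ∀ M, X M → IsBrick M
  hom_eq_zero : ∀ M N, X M → X N → ¬ Nonempty (M ≅ N) → ∀ f : M ⟶ N, f = 0

variable (𝓔 : ExtriangulatedStructure.{w} C)

/-- `A --x--> B --y--> D --δ-->` is an `𝔼`-triangle. -/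
def IsTriangle {A B D : C} (x : A ⟶ B) (y : B ⟶ D) (δ : Ext 𝓔.E D A) : Prop :=
  𝓔.s δ = ⟦⟨B, x, y⟩⟧

/-- `M` admits a filtration `0 = M₀ ⟶ M₁ ⟶ ⋯ ⟶ Mₙ = M` of length `n` by inflations whose cones
are in `X`. -/
inductive HasFiltration (X : ObjectProperty C) : ℕ → C → Prop
  | zero (M : C) (hM : IsZero M) : HasFiltration X 0 M
  | succ {n : ℕ} {L M S : C} (f : L ⟶ M) (g : M ⟶ S) (δ : Ext 𝓔.E S L)
      (hL : HasFiltration X n L) (h : IsTriangle 𝓔 f g δ) (hS : X S) : HasFiltration X (n + 1) M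

/-- The filtration subcategory generated by `X`. -/
def Filt (X : ObjectProperty C) : ObjectProperty C :=
  fun M => ∃ n, HasFiltration 𝓔 X n M

/-- The `X`-length of an object of `Filt X`: the minimal length of its `X`-filtrations. -/
noncomputable def filtLength (X : ObjectProperty C) (M : (Filt 𝓔 X).FullSubcategory) : ℕ :=
  sInf {n | HasFiltration 𝓔 X n M.obj}

/-- An extension-closed (full, isomorphism-closed, additive) subcategory. It carries the
restrictions of `𝔼` and `𝔰`, so that its `𝔼`-triangles are the `𝔼`-triangles of the ambient
category all of whose terms are in `P`. -/
structure IsExtensionClosed (P : ObjectProperty C) : Prop where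
  iso_closed : P.IsClosedUnderIsomorphisms
  zero_mem : ∀ M, IsZero M → P M
  ext_mem : ∀ {A B D : C} (x : A ⟶ B) (y : B ⟶ D) (δ : Ext 𝓔.E D A),
    IsTriangle 𝓔 x y δ → P A → P D → P B

section Length

variable {P : ObjectProperty C} (Θ : P.FullSubcategory → ℕ)

/-- `Θ` is a length function on the extension-closed subcategory `P`. A function on isomorphism
classes is given by a function on objects that is invariant under isomorphism. -/
structure IsLengthFunction : Prop where
  iso_invariant : ∀ M N : P.FullSubcategory, Nonempty (M.obj ≅ N.obj) → Θ M = Θ N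
  eq_zero_iff : ∀ M : P.FullSubcategory, Θ M = 0 ↔ IsZero M.obj
  le_add : ∀ {X L M : P.FullSubcategory} (x : X.obj ⟶ L.obj) (y : L.obj ⟶ M.obj)
    (δ : Ext 𝓔.E M.obj X.obj), IsTriangle 𝓔 x y δ → Θ L ≤ Θ X + Θ M
  eq_add : ∀ {X L M : P.FullSubcategory} (x : X.obj ⟶ L.obj) (y : L.obj ⟶ M.obj),
    IsTriangle 𝓔 x y 0 → Θ L = Θ X + Θ M

/-- A `Θ`-stable `𝔼`-triangle of the subcategory `P`. -/
def IsStableTriangle {X L M : P.FullSubcategory} (x : X.obj ⟶ L.obj) (y : L.obj ⟶ M.obj)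
    (δ : Ext 𝓔.E M.obj X.obj) : Prop :=
  IsTriangle 𝓔 x y δ ∧ Θ L = Θ X + Θ M

/-- `Θ`-inflations. -/
def IsThetaInflation {X L : P.FullSubcategory} (x : X.obj ⟶ L.obj) : Prop :=
  ∃ (M : P.FullSubcategory) (y : L.obj ⟶ M.obj) (δ : Ext 𝓔.E M.obj X.obj),
    IsStableTriangle 𝓔 Θ x y δ

/-- `Θ`-deflations. -/
def IsThetaDeflation {L M : P.FullSubcategory} (y : L.obj ⟶ M.obj) : Prop :=
  ∃ (X : P.FullSubcategory) (x : X.obj ⟶ L.obj) (δ : Ext 𝓔.E M.obj X.obj),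
    IsStableTriangle 𝓔 Θ x y δ

/-- `f` is `Θ`-admissible: it is a `Θ`-deflation followed by a `Θ`-inflation. -/
def IsAdmissible {M N : P.FullSubcategory} (f : M.obj ⟶ N.obj) : Prop :=
  ∃ (Z : P.FullSubcategory) (i : M.obj ⟶ Z.obj) (j : Z.obj ⟶ N.obj),
    i ≫ j = f ∧ IsThetaDeflation 𝓔 Θ i ∧ IsThetaInflation 𝓔 Θ j

/-- The class `Θ₁` of the non-zero objects of minimal length. -/
def thetaOne (M : P.FullSubcategory) : Prop :=
  ¬ IsZero M.obj ∧ ∀ N : P.FullSubcategory, ¬ IsZero N.obj → Θ M ≤ Θ N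

/-- `thetaLevel Θ n` is the class `Θₙ₊₁`: it starts with `Θ₁`, and `Θₙ₊₂` is the union of `Θₙ₊₁`
and the class of the objects of length `n + 2` that have no non-zero morphism from or to an object
of `Θₙ₊₁`. -/
def thetaLevel : ℕ → P.FullSubcategory → Prop
  | 0 => thetaOne Θ
  | n + 1 => fun M => thetaLevel n M ∨
      ((∀ N : P.FullSubcategory, thetaLevel n N →
          (∀ f : N.obj ⟶ M.obj, f = 0) ∧ (∀ f : M.obj ⟶ N.obj, f = 0)) ∧ Θ M = n + 2)

/-- The union `Θ_∞` of all `Θₙ`, `n ≥ 1`. -/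
def thetaInfty (M : P.FullSubcategory) : Prop :=
  ∃ n, thetaLevel Θ n M

/-- `(P, Θ)` is a length subcategory. Length functions are normalized: the objects in `Θ₁` have
length `1`. -/
structure IsLengthSubcategory : Prop where
  extensionClosed : IsExtensionClosed 𝓔 P
  lengthFunction : IsLengthFunction 𝓔 Θ
  admissible : ∀ {M N : P.FullSubcategory} (f : M.obj ⟶ N.obj), IsAdmissible 𝓔 Θ f
  normalized : ∀ M : P.FullSubcategory, thetaOne Θ M → Θ M = 1

/-- A simple object of `(P, Θ)`: a non-zero object that is not the middle term of a `Θ`-stable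
`𝔼`-triangle with non-zero end terms. -/
def IsSimple (M : P.FullSubcategory) : Prop :=
  ¬ IsZero M.obj ∧ ¬ ∃ (A B : P.FullSubcategory) (x : A.obj ⟶ M.obj) (y : M.obj ⟶ B.obj)
    (δ : Ext 𝓔.E B.obj A.obj), IsStableTriangle 𝓔 Θ x y δ ∧ ¬ IsZero A.obj ∧ ¬ IsZero B.obj

end Length

/-- A pair `(P, Θ)` of a full subcategory and a function on its objects. -/
abbrev SubcategoryWithLength (C : Type u) [Category.{v} C] : Type u :=
  Σ P : ObjectProperty C, (P.FullSubcategory → ℕ)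

/-- `(P, Θ)` is a length wide subcategory: a length subcategory with `Θ₁ = Θ_∞`. -/
def IsLengthWide (W : SubcategoryWithLength C) : Prop :=
  IsLengthSubcategory 𝓔 W.2 ∧ thetaOne W.2 = thetaInfty W.2

/-- The pair `(Filt X, l_X)`. -/
noncomputable def filtPair (X : ObjectProperty C) : SubcategoryWithLength C :=
  ⟨Filt 𝓔 X, filtLength 𝓔 X⟩

/-- The class of simple objects of `(P, Θ)`. -/
def sim (W : SubcategoryWithLength C) : ObjectProperty C :=
  fun M => ∃ h : W.1 M, IsSimple 𝓔 W.2 ⟨M, h⟩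

end Extri

set_option linter.unusedSectionVars false

open scoped ZeroObject

/-! For a semibrick `X`, the filtration length behaves like composition length in an abelian
category. The key fact is that a non-zero morphism between a filtered object and an object of `X`,
in either direction, belongs to a triangle whose remaining term has a filtration shorter by one
(`exists_triangle_of_hom_to`, `exists_triangle_of_hom_from`). Hence such a triangle is stable. This
makes length additive on split triangles (`filtLength_split`), and a morphism killing no non-zero
morphism from an object of `X` is a stable inflation (`isThetaInflation_of_injective`). Any morphism
is made injective in this sense by successively dividing out objects of `X` that it kills, so it is
admissible. Every non-zero filtered object maps non-trivially to `X`, so no class `Θₙ` adds an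
object to `Θ₁`, and a simple object is isomorphic to an object of `X`.

Conversely, admissibility gives Schur's lemma, so the simple objects form a semibrick. By Schur, a
simple object of length at least two has no non-zero morphism from or to an object of length one.
The equality `Θ₁ = Θ_∞` therefore forces every simple object to have length one. Splitting along
stable triangles then gives a filtration of `M` by simples of length `Θ M`, and subadditivity shows
that none is shorter. -/

namespace Extri

variable {C : Type u} [Category.{v} C] [Preadditive C] [HasZeroObject C] [HasBinaryBiproducts C]
  {𝓔 : ExtriangulatedStructure.{w} C}

/-! ### Functoriality and additivity of extension classes. -/

section PushPull

@[simp]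
lemma push_id {Z X : C} (δ : Ext 𝓔.E Z X) : push (𝟙 X) δ = δ := by
  simp [push]

@[simp]
lemma pull_id {Z X : C} (δ : Ext 𝓔.E Z X) : pull (𝟙 Z) δ = δ := by
  simp [pull]

lemma push_comp {Z X X' X'' : C} (a : X ⟶ X') (b : X' ⟶ X'') (δ : Ext 𝓔.E Z X) :
    push (a ≫ b) δ = push b (push a δ) := by
  simp [push]

lemma pull_comp {Z Z' Z'' X : C} (a : Z'' ⟶ Z') (b : Z' ⟶ Z) (δ : Ext 𝓔.E Z X) :
    pull (a ≫ b) δ = pull a (pull b δ) := by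
  simp [pull]

@[simp]
lemma push_zero {Z X X' : C} (a : X ⟶ X') : push a (0 : Ext 𝓔.E Z X) = 0 := by
  simp [push]

@[simp]
lemma pull_zero {Z Z' X : C} (c : Z' ⟶ Z) : pull c (0 : Ext 𝓔.E Z X) = 0 := by
  simp [pull]

lemma push_sub {Z X X' : C} (a b : X ⟶ X') (δ : Ext 𝓔.E Z X) :
    push (a - b) δ = push a δ - push b δ := by
  have := 𝓔.additive_right (op Z)
  simp [push, Functor.map_sub]

@[simp]
lemma zero_push {Z X X' : C} (δ : Ext 𝓔.E Z X) : push (0 : X ⟶ X') δ = 0 := by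
  have := 𝓔.additive_right (op Z)
  simp [push]

@[simp]
lemma zero_pull {Z Z' X : C} (δ : Ext 𝓔.E Z X) : pull (0 : Z' ⟶ Z) δ = 0 := by
  have := 𝓔.additive_left X
  have h : (𝓔.E.flip.obj X).map (0 : op Z ⟶ op Z') = 0 := Functor.map_zero _ _ _
  have h' : (𝓔.E.map (0 : Z' ⟶ Z).op).app X = 0 := h
  rw [pull, h']
  rfl

lemma ext_eq_zero_of_isZero_left {Z X : C} (hZ : IsZero Z) (δ : Ext 𝓔.E Z X) : δ = 0 := by
  rw [← pull_id δ, hZ.eq_of_src (𝟙 Z) 0, zero_pull]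

lemma ext_eq_zero_of_isZero_right {Z X : C} (hX : IsZero X) (δ : Ext 𝓔.E Z X) : δ = 0 := by
  rw [← push_id δ, hX.eq_of_src (𝟙 X) 0, zero_push]

end PushPull

/-! ### Criteria for invertibility. -/

section Isomorphisms

/-- With `a = 1 + n` and `n² = 0`, the inverse is `1 - n = 2 - a`. -/
lemma isIso_of_sub_id_comp_self {A : C} (a : A ⟶ A) (h : (a - 𝟙 A) ≫ (a - 𝟙 A) = 0) :
    IsIso a := by
  simp only [Preadditive.sub_comp, Preadditive.comp_sub, Category.comp_id, Category.id_comp] at h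
  have h₁ : a ≫ a = a + a - 𝟙 A := by
    rw [← sub_eq_zero, ← h]; abel
  exact ⟨𝟙 A + 𝟙 A - a, by simp [Preadditive.comp_sub, Preadditive.comp_add, h₁],
    by simp [Preadditive.sub_comp, Preadditive.add_comp, h₁]⟩

lemma isIso_of_isIso_comp_comp {A B : C} (a : A ⟶ B) (b : B ⟶ A) [IsIso (a ≫ b)]
    [IsIso (b ≫ a)] : IsIso a := by
  have : IsSplitMono a := ⟨⟨b ≫ inv (a ≫ b), by rw [← Category.assoc, IsIso.hom_inv_id]⟩⟩
  have : Epi a := epi_of_epi b a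
  exact isIso_of_epi_of_isSplitMono a

end Isomorphisms

/-! ### Exactness, splitting and uniqueness for triangles. -/

namespace IsTriangle

variable {A B D : C} {x : A ⟶ B} {y : B ⟶ D} {δ : Ext 𝓔.E D A}

lemma of_iso (h : IsTriangle 𝓔 x y δ) {B' : C} (e : B ≅ B') {x' : A ⟶ B'} {y' : B' ⟶ D}
    (hx : x ≫ e.hom = x') (hy : e.hom ≫ y' = y) : IsTriangle 𝓔 x' y' δ :=
  Eq.trans h (Quotient.sound ⟨e, hx, hy⟩)

lemma exists_iso (h : IsTriangle 𝓔 x y δ) {B' : C} {x' : A ⟶ B'} {y' : B' ⟶ D}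
    (h' : IsTriangle 𝓔 x' y' δ) : ∃ e : B ≅ B', x ≫ e.hom = x' ∧ e.hom ≫ y' = y :=
  Quotient.exact (h.symm.trans h')

lemma exists_biprod_iso (h : IsTriangle 𝓔 x y (0 : Ext 𝓔.E D A)) :
    ∃ e : B ≅ A ⊞ D, x ≫ e.hom = biprod.inl ∧ e.hom ≫ biprod.snd = y :=
  h.exists_iso (𝓔.realization_zero A D)

lemma of_isIso_left (x : A ⟶ B) [IsIso x] (y : B ⟶ D) (hD : IsZero D) :
    IsTriangle 𝓔 x y 0 := by
  have h : IsTriangle 𝓔 _ _ _ := 𝓔.realization_zero A D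
  refine h.of_iso ⟨biprod.fst ≫ x, inv x ≫ biprod.inl, ?_, by simp⟩ (by simp) (hD.eq_of_tgt _ _)
  ext
  · simp
  · simp
  · exact hD.eq_of_src _ _
  · exact hD.eq_of_src _ _

lemma of_isIso_right (x : A ⟶ B) (y : B ⟶ D) [IsIso y] (hA : IsZero A) :
    IsTriangle 𝓔 x y 0 := by
  have h : IsTriangle 𝓔 _ _ _ := 𝓔.realization_zero A D
  refine h.of_iso ⟨biprod.snd ≫ inv y, y ≫ biprod.inr, ?_, by simp⟩ (hA.eq_of_src _ _) (by simp)
  ext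
  · exact hA.eq_of_src _ _
  · exact hA.eq_of_src _ _
  · simp
  · simp

lemma isIso_left (h : IsTriangle 𝓔 x y δ) (hD : IsZero D) : IsIso x := by
  obtain rfl := ext_eq_zero_of_isZero_left hD δ
  obtain ⟨e, he, -⟩ := h.exists_biprod_iso
  have h₁ : biprod.snd (X := A) (Y := D) = 0 := hD.eq_of_tgt _ _
  have h₂ : IsIso (biprod.inl : A ⟶ A ⊞ D) :=
    ⟨biprod.fst, by simp, by rw [← biprod.total, h₁]; simp⟩
  rw [← Iso.eq_comp_inv] at he
  rw [he]
  infer_instance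

lemma isIso_right (h : IsTriangle 𝓔 x y δ) (hA : IsZero A) : IsIso y := by
  obtain rfl := ext_eq_zero_of_isZero_right hA δ
  obtain ⟨e, -, he⟩ := h.exists_biprod_iso
  have h₁ : biprod.fst (X := A) (Y := D) = 0 := hA.eq_of_tgt _ _
  have h₂ : IsIso (biprod.snd : A ⊞ D ⟶ D) :=
    ⟨biprod.inr, by rw [← biprod.total, h₁]; simp, by simp⟩
  rw [← he]
  infer_instance

/-- This and the next lemmas are the exactness of the long Hom–𝔼 sequences. Each compares the given
triangle with a trivial one, `T = T ⟶ 0` or `0 ⟶ T = T`. -/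
lemma comp_eq_zero (h : IsTriangle 𝓔 x y δ) : x ≫ y = 0 := by
  obtain ⟨c, hc, -⟩ := 𝓔.et3 (of_isIso_left (𝓔 := 𝓔) (𝟙 A) (0 : A ⟶ 0) (isZero_zero C)) h
    (𝟙 A) x (by simp)
  simpa using hc.symm

lemma exists_lift (h : IsTriangle 𝓔 x y δ) {T : C} (t : T ⟶ B) (ht : t ≫ y = 0) :
    ∃ s : T ⟶ A, s ≫ x = t := by
  obtain ⟨a, ha, -⟩ := 𝓔.et3op (of_isIso_left (𝓔 := 𝓔) (𝟙 T) (0 : T ⟶ 0) (isZero_zero C)) h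
    t 0 (by simp [ht])
  exact ⟨a, by simpa using ha.symm⟩

lemma exists_desc (h : IsTriangle 𝓔 x y δ) {T : C} (t : B ⟶ T) (ht : x ≫ t = 0) :
    ∃ s : D ⟶ T, y ≫ s = t := by
  obtain ⟨c, hc, -⟩ := 𝓔.et3 h (of_isIso_right (𝓔 := 𝓔) (0 : 0 ⟶ T) (𝟙 T) (isZero_zero C))
    0 t (by simp [ht])
  exact ⟨c, by simpa using hc⟩

lemma exists_extend (h : IsTriangle 𝓔 x y δ) {T : C} (a : A ⟶ T) (ha : push a δ = 0) :
    ∃ r : B ⟶ T, x ≫ r = a := by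
  obtain ⟨b, hb, -⟩ := 𝓔.realization h
    (of_isIso_left (𝓔 := 𝓔) (𝟙 T) (0 : T ⟶ 0) (isZero_zero C)) a 0 (by simp [ha])
  exact ⟨b, by simpa using hb⟩

lemma exists_coextend (h : IsTriangle 𝓔 x y δ) {T : C} (c : T ⟶ D) (hc : pull c δ = 0) :
    ∃ r : T ⟶ B, r ≫ y = c := by
  obtain ⟨b, -, hb⟩ := 𝓔.realization
    (of_isIso_right (𝓔 := 𝓔) (0 : 0 ⟶ T) (𝟙 T) (isZero_zero C)) h 0 c (by simp [hc])
  exact ⟨b, by simpa using hb.symm⟩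

lemma push_eq_zero (h : IsTriangle 𝓔 x y δ) : push x δ = 0 := by
  obtain ⟨c, -, hc⟩ := 𝓔.et3 h (of_isIso_left (𝓔 := 𝓔) (𝟙 B) (0 : B ⟶ 0) (isZero_zero C))
    x (𝟙 B) (by simp)
  simpa using hc

lemma pull_eq_zero (h : IsTriangle 𝓔 x y δ) : pull y δ = 0 := by
  obtain ⟨c, -, hc⟩ := 𝓔.et3op (of_isIso_right (𝓔 := 𝓔) (0 : 0 ⟶ B) (𝟙 B) (isZero_zero C)) h
    (𝟙 B) y (by simp)
  simpa using hc.symm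

/-- If the deflation of a triangle becomes invertible after composition with a morphism `i`, then
`i` is an inflation with cone the first term. -/
lemma of_comp_isIso_left (h : IsTriangle 𝓔 x y δ) {S : C} (i : S ⟶ B) [IsIso (i ≫ y)] :
    ∃ r : B ⟶ A, IsTriangle 𝓔 i r 0 := by
  have hδ : δ = 0 := by
    rw [← pull_id δ, ← IsIso.inv_hom_id (i ≫ y), ← Category.assoc, pull_comp, h.pull_eq_zero,
      pull_zero]
  -- An inflation need not be monic; the retraction `r₀`, available because `δ = 0`, allows `x` to
  -- be cancelled on the right below.
  obtain ⟨r₀, hr₀⟩ := h.exists_extend (𝟙 A) (by simp [hδ])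
  -- The idempotent complementary to projection onto `S` is killed by `y`, so it factors through
  -- `x`; the factor `t` is the projection onto `A`.
  obtain ⟨t, ht⟩ := h.exists_lift (𝟙 B - y ≫ inv (i ≫ y) ≫ i) (by simp [Preadditive.sub_comp])
  have hxt : x ≫ t = 𝟙 A := by
    have : x ≫ t ≫ x ≫ r₀ = x ≫ r₀ := by
      rw [reassoc_of% ht]
      simp [Preadditive.comp_sub, Preadditive.sub_comp, reassoc_of% h.comp_eq_zero]
    simpa [hr₀] using this
  have hit : i ≫ t = 0 := by
    have : i ≫ t ≫ x ≫ r₀ = 0 := by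
      rw [reassoc_of% ht]
      have := IsIso.hom_inv_id_assoc (i ≫ y) (i ≫ r₀)
      simp only [Category.assoc] at this
      simp [Preadditive.comp_sub, Preadditive.sub_comp, this]
    simpa [hr₀] using this
  have h₀ : IsTriangle 𝓔 _ _ _ := 𝓔.realization_zero S A
  refine ⟨t, h₀.of_iso ⟨biprod.desc i x, biprod.lift (y ≫ inv (i ≫ y)) t, ?_, ?_⟩ (by simp) ?_⟩
  · ext
    · have := IsIso.hom_inv_id (i ≫ y)
      rw [Category.assoc] at this
      simp [this]
    · simp [hit]
    · simp [reassoc_of% h.comp_eq_zero]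
    · simp [hxt]
  · simp [biprod.lift_desc, ht]
  · ext <;> simp [hit, hxt]

/-- If the inflation of a triangle becomes invertible after composition with a morphism `f`, then
`f` is a deflation with cocone the third term. -/
lemma of_comp_isIso_right (h : IsTriangle 𝓔 x y δ) {S : C} (f : B ⟶ S) [IsIso (x ≫ f)] :
    ∃ k : D ⟶ B, IsTriangle 𝓔 k f 0 := by
  have hδ : δ = 0 := by
    rw [← push_id δ, ← IsIso.hom_inv_id (x ≫ f), Category.assoc, push_comp, h.push_eq_zero,
      push_zero]
  obtain ⟨s₀, hs₀⟩ := h.exists_coextend (𝟙 D) (by simp [hδ])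
  obtain ⟨t, ht⟩ := h.exists_desc (𝟙 B - f ≫ inv (x ≫ f) ≫ x) (by
    have := IsIso.hom_inv_id_assoc (x ≫ f) x
    simp only [Category.assoc] at this
    simp [Preadditive.comp_sub, this])
  have hty : t ≫ y = 𝟙 D := by
    have : s₀ ≫ y ≫ t ≫ y = s₀ ≫ y := by
      rw [reassoc_of% ht]
      simp [Preadditive.sub_comp, h.comp_eq_zero]
    simpa [reassoc_of% hs₀, hs₀] using this
  have htf : t ≫ f = 0 := by
    have : s₀ ≫ y ≫ t ≫ f = 0 := by
      rw [reassoc_of% ht]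
      simp [Preadditive.sub_comp]
    simpa [reassoc_of% hs₀] using this
  have h₀ : IsTriangle 𝓔 _ _ _ := 𝓔.realization_zero D S
  refine ⟨t, h₀.of_iso ⟨biprod.desc t (inv (x ≫ f) ≫ x), biprod.lift y f, ?_, ?_⟩ (by simp) ?_⟩
  · ext
    · simp [hty]
    · simp [htf]
    · simp [h.comp_eq_zero]
    · simp
  · simp [biprod.lift_desc, ht]
  · ext <;> simp [htf]

/-- Since `a - 1` kills `δ`, it factors through `x`, and `(a - 1) ≫ x = 0`; so `a - 1` squares to
zero. -/
lemma isIso_of_push_eq (h : IsTriangle 𝓔 x y δ) (a : A ⟶ A) (hax : a ≫ x = x)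
    (ha : push a δ = δ) : IsIso a := by
  obtain ⟨r, hr⟩ := h.exists_extend (a - 𝟙 A) (by simp [push_sub, ha])
  have hx : (a - 𝟙 A) ≫ x = 0 := by simp [Preadditive.sub_comp, hax]
  apply isIso_of_sub_id_comp_self
  nth_rw 2 [← hr]
  rw [reassoc_of% hx, zero_comp]

lemma isIso_of_fill (h : IsTriangle 𝓔 x y δ) (b : B ⟶ B) (hxb : x ≫ b = x)
    (hby : b ≫ y = y) : IsIso b := by
  obtain ⟨r, hr⟩ := h.exists_desc (b - 𝟙 B) (by simp [Preadditive.comp_sub, hxb])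
  have hy : (b - 𝟙 B) ≫ y = 0 := by simp [Preadditive.sub_comp, hby]
  apply isIso_of_sub_id_comp_self
  nth_rw 2 [← hr]
  rw [reassoc_of% hy, zero_comp]

/-- The first term of a triangle may be replaced by an isomorphic object. -/
lemma iso_comp (h : IsTriangle 𝓔 x y δ) {A' : C} (a : A' ≅ A) :
    IsTriangle 𝓔 (a.hom ≫ x) y (push a.inv δ) := by
  obtain ⟨⟨B', x', y'⟩, h'⟩ := Quotient.exists_rep (𝓔.s (push a.inv δ))
  obtain ⟨b, hb, hb'⟩ := 𝓔.realization h h'.symm a.inv (𝟙 D) (by simp)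
  -- The composites of `b` and `c` fix both morphisms of their triangles, so they are invertible by
  -- `isIso_of_fill`.
  obtain ⟨c, hc, hc'⟩ := 𝓔.realization h'.symm h a.hom (𝟙 D) (by simp [← push_comp])
  simp only [Category.comp_id] at hb hb' hc hc'
  have h₁ : IsIso (b ≫ c) := h.isIso_of_fill _ (by simp [reassoc_of% hb, hc])
    (by rw [Category.assoc, ← hc', ← hb'])
  have h₂ : IsIso (c ≫ b) := isIso_of_fill h'.symm _ (by simp [reassoc_of% hc, hb])
    (by rw [Category.assoc, ← hb', ← hc'])
  have := isIso_of_isIso_comp_comp b c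
  have h'' : IsTriangle 𝓔 x' y' (push a.inv δ) := h'.symm
  exact h''.of_iso (asIso b).symm (by simp [hb]) (by simp [hb'])

/-- The cocone of a deflation is unique up to isomorphism. -/
lemma nonempty_iso_of_deflation (h : IsTriangle 𝓔 x y δ) {A' : C} {x' : A' ⟶ B}
    {δ' : Ext 𝓔.E D A'} (h' : IsTriangle 𝓔 x' y δ') : Nonempty (A ≅ A') := by
  obtain ⟨a, ha, ha'⟩ := 𝓔.et3op h h' (𝟙 B) (𝟙 D) (by simp)
  obtain ⟨b, hb, hb'⟩ := 𝓔.et3op h' h (𝟙 B) (𝟙 D) (by simp)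
  simp only [Category.comp_id, pull_id] at ha ha' hb hb'
  have h₁ : IsIso (a ≫ b) := h.isIso_of_push_eq _ (by rw [Category.assoc, ← hb, ← ha])
    (by rw [push_comp, ha', hb'])
  have h₂ : IsIso (b ≫ a) := h'.isIso_of_push_eq _ (by rw [Category.assoc, ← ha, ← hb])
    (by rw [push_comp, hb', ha'])
  have := isIso_of_isIso_comp_comp a b
  exact ⟨asIso a⟩

end IsTriangle

/-! ### Objects filtered by a semibrick and their length. -/

section Filtrations

variable {X : ObjectProperty C}

lemma IsBrick.not_isZero {M : C} (hM : IsBrick M) : ¬ IsZero M := by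
  intro h
  have := hM.1
  exact zero_ne_one (α := End M) (h.eq_of_src _ _)

lemma IsSemibrick.isIso_of_ne_zero (hX : IsSemibrick X) {S T : C} (hS : X S) (hT : X T)
    (f : S ⟶ T) (hf : f ≠ 0) : IsIso f := by
  by_cases h : Nonempty (S ≅ T)
  · obtain ⟨e⟩ := h
    have h₁ : f ≫ e.inv ≠ 0 := by
      intro h₀
      apply hf
      simpa using h₀ =≫ e.hom
    have h₂ : IsIso (f ≫ e.inv) :=
      (isUnit_iff_isIso (f ≫ e.inv)).1 ((hX.brick S hS).2 (f ≫ e.inv : End S) h₁)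
    have : f = (f ≫ e.inv) ≫ e.hom := by simp
    rw [this]
    infer_instance
  · exact absurd (hX.hom_eq_zero S T hS hT h f) hf

namespace HasFiltration

lemma of_iso {n : ℕ} {M N : C} (h : HasFiltration 𝓔 X n M) (e : M ≅ N) :
    HasFiltration 𝓔 X n N := by
  cases h with
  | zero _ hM => exact .zero _ (hM.of_iso e.symm)
  | succ f g δ hL h hS =>
    exact .succ (f ≫ e.hom) (e.inv ≫ g) δ hL (h.of_iso e rfl (by simp)) hS

lemma isZero {M : C} (h : HasFiltration 𝓔 X 0 M) : IsZero M := by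
  cases h
  assumption

lemma of_mem {S : C} (hS : X S) : HasFiltration 𝓔 X 1 S :=
  .succ (0 : (0 : C) ⟶ S) (𝟙 S) 0 (.zero _ (isZero_zero C))
    (IsTriangle.of_isIso_right _ _ (isZero_zero C)) hS

/-- The lengths of filtrations add up in extensions. -/
lemma extension {m n : ℕ} {A B D : C} {x : A ⟶ B} {y : B ⟶ D} {δ : Ext 𝓔.E D A}
    (hA : HasFiltration 𝓔 X m A) (hD : HasFiltration 𝓔 X n D) (h : IsTriangle 𝓔 x y δ) :
    HasFiltration 𝓔 X (m + n) B := by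
  induction hD generalizing B with
  | zero D hD =>
    have := h.isIso_left hD
    exact hA.of_iso (asIso x)
  | succ f g ε _ hε hS ih =>
    obtain ⟨N, d, e, k, δ', hδ', -, -, hN, -, -⟩ := 𝓔.et4op h hε
    exact .succ k _ δ' (ih hN) hδ' hS

/-- Filtrations are built by adding a factor at the top; (ET4) lets one peel off the bottom factor
instead. -/
lemma exists_inflation {n : ℕ} {M : C} (h : HasFiltration 𝓔 X (n + 1) M) :
    ∃ (S L : C) (i : S ⟶ M) (p : M ⟶ L) (δ : Ext 𝓔.E L S),
      X S ∧ HasFiltration 𝓔 X n L ∧ IsTriangle 𝓔 i p δ := by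
  induction n generalizing M with
  | zero =>
    cases h with
    | succ f g δ hL h hS =>
      have := h.isIso_right hL.isZero
      exact ⟨_, 0, inv g, 0, 0, hS, .zero _ (isZero_zero C),
        IsTriangle.of_isIso_left _ _ (isZero_zero C)⟩
  | succ n ih =>
    cases h with
    | succ f g δ hL h hS =>
      obtain ⟨S, L', i, p, ε, hS', hL', hε⟩ := ih hL
      obtain ⟨N, d, e, k, δ', hδ', -, -, hN, -, -⟩ := 𝓔.et4 hε h
      exact ⟨S, N, i ≫ f, k, δ', hS', .succ d e _ hL' hN hS, hδ'⟩

lemma hom_eq_zero_of_src {n : ℕ} {M N : C} (hN : HasFiltration 𝓔 X n N)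
    (h : ∀ S, X S → ∀ f : M ⟶ S, f = 0) (f : M ⟶ N) : f = 0 := by
  induction hN with
  | zero N hN => exact hN.eq_of_tgt _ _
  | succ i g δ _ ht hS ih =>
    obtain ⟨s, rfl⟩ := ht.exists_lift f (h _ hS _)
    rw [ih s, zero_comp]

lemma hom_eq_zero_of_tgt {n : ℕ} {M N : C} (hN : HasFiltration 𝓔 X n N)
    (h : ∀ S, X S → ∀ f : S ⟶ M, f = 0) (f : N ⟶ M) : f = 0 := by
  induction hN with
  | zero N hN => exact hN.eq_of_src _ _
  | succ i g δ _ ht hS ih =>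
    obtain ⟨s, rfl⟩ := ht.exists_desc f (ih _)
    rw [h _ hS s, comp_zero]

lemma exists_hom_to_ne_zero {n : ℕ} {M : C} (hM : HasFiltration 𝓔 X n M) (h₀ : ¬ IsZero M) :
    ∃ (S : C) (f : M ⟶ S), X S ∧ f ≠ 0 := by
  by_contra! h
  exact h₀ ((IsZero.iff_id_eq_zero M).2 (hM.hom_eq_zero_of_src (fun S hS f => h S f hS) _))

lemma exists_hom_from_ne_zero {n : ℕ} {M : C} (hM : HasFiltration 𝓔 X n M) (h₀ : ¬ IsZero M) :
    ∃ (S : C) (f : S ⟶ M), X S ∧ f ≠ 0 := by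
  by_contra! h
  exact h₀ ((IsZero.iff_id_eq_zero M).2 (hM.hom_eq_zero_of_tgt (fun S hS f => h S f hS) _))

/-- A non-zero morphism from a filtered object to an object of a semibrick is a deflation. -/
lemma exists_triangle_of_hom_to (hX : IsSemibrick X) {n : ℕ} {M S : C}
    (hM : HasFiltration 𝓔 X (n + 1) M) (hS : X S) (f : M ⟶ S) (hf : f ≠ 0) :
    ∃ (K : C) (k : K ⟶ M) (δ : Ext 𝓔.E S K), HasFiltration 𝓔 X n K ∧ IsTriangle 𝓔 k f δ := by
  induction n generalizing M with
  | zero =>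
    obtain ⟨T, L, i, p, δ, hT, hL, ht⟩ := hM.exists_inflation
    have := ht.isIso_left hL.isZero
    have := hX.isIso_of_ne_zero hT hS (i ≫ f) (fun h => hf (by simpa using inv i ≫= h))
    have : IsIso f := IsIso.of_isIso_comp_left i f
    exact ⟨0, 0, 0, .zero _ (isZero_zero C), IsTriangle.of_isIso_right _ _ (isZero_zero C)⟩
  | succ n ih =>
    obtain ⟨T, L, i, p, δ, hT, hL, ht⟩ := hM.exists_inflation
    by_cases h₀ : i ≫ f = 0
    · obtain ⟨f, rfl⟩ := ht.exists_desc f h₀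
      obtain ⟨K, k, ε, hK, hk⟩ := ih hL f (fun h => hf (by simp [h]))
      obtain ⟨N, d, e, q, δ', hδ', -, -, hN, -, -⟩ := 𝓔.et4op ht hk
      refine ⟨N, q, δ', ?_, hδ'⟩
      rw [add_comm]
      exact (of_mem hT).extension hK hN
    -- By Schur, `f` is invertible on the bottom factor, which therefore splits off, leaving `L` as
    -- the cocone of `f`.
    · have := hX.isIso_of_ne_zero hT hS _ h₀
      obtain ⟨k, hk⟩ := ht.of_comp_isIso_right f
      exact ⟨L, k, 0, hL, hk⟩

/-- A non-zero morphism from an object of a semibrick to a filtered object is an inflation. -/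
lemma exists_triangle_of_hom_from (hX : IsSemibrick X) {n : ℕ} {M S : C}
    (hM : HasFiltration 𝓔 X (n + 1) M) (hS : X S) (f : S ⟶ M) (hf : f ≠ 0) :
    ∃ (L : C) (p : M ⟶ L) (δ : Ext 𝓔.E L S), HasFiltration 𝓔 X n L ∧ IsTriangle 𝓔 f p δ := by
  induction n generalizing M with
  | zero =>
    cases hM with
    | succ j g δ hL ht hT =>
      have := ht.isIso_right hL.isZero
      have := hX.isIso_of_ne_zero hS hT (f ≫ g) (fun h => hf (by simpa using h =≫ inv g))
      have : IsIso f := IsIso.of_isIso_comp_right f g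
      exact ⟨0, 0, 0, .zero _ (isZero_zero C), IsTriangle.of_isIso_left _ _ (isZero_zero C)⟩
  | succ n ih =>
    cases hM with
    | succ j g δ hL ht hT =>
      by_cases h₀ : f ≫ g = 0
      · obtain ⟨f, rfl⟩ := ht.exists_lift f h₀
        obtain ⟨K, k, ε, hK, hk⟩ := ih hL f (fun h => hf (by simp [h]))
        obtain ⟨N, d, e, q, δ', hδ', -, -, hN, -, -⟩ := 𝓔.et4 hk ht
        exact ⟨N, q, δ', .succ d e _ hK hN hT, hδ'⟩
      · have := hX.isIso_of_ne_zero hS hT _ h₀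
        obtain ⟨k, hk⟩ := ht.of_comp_isIso_left f
        exact ⟨_, k, 0, hL, hk⟩

end HasFiltration

lemma filt_isExtensionClosed (X : ObjectProperty C) : IsExtensionClosed 𝓔 (Filt 𝓔 X) where
  iso_closed := ⟨fun e ⟨n, h⟩ => ⟨n, h.of_iso e⟩⟩
  zero_mem M hM := ⟨0, .zero M hM⟩
  ext_mem := by
    rintro A B D x y δ h ⟨m, hA⟩ ⟨n, hD⟩
    exact ⟨_, hA.extension hD h⟩

lemma hasFiltration_filtLength (M : (Filt 𝓔 X).FullSubcategory) :
    HasFiltration 𝓔 X (filtLength 𝓔 X M) M.obj :=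
  Nat.sInf_mem (s := {n | HasFiltration 𝓔 X n M.obj}) M.property

lemma filtLength_le {M : (Filt 𝓔 X).FullSubcategory} {n : ℕ} (h : HasFiltration 𝓔 X n M.obj) :
    filtLength 𝓔 X M ≤ n :=
  Nat.sInf_le h

lemma filtLength_eq_zero_iff (M : (Filt 𝓔 X).FullSubcategory) :
    filtLength 𝓔 X M = 0 ↔ IsZero M.obj := by
  refine ⟨fun h => ?_, fun h => Nat.le_zero.1 (filtLength_le (.zero _ h))⟩
  have := hasFiltration_filtLength M
  rw [h] at this
  exact this.isZero

lemma filtLength_congr {M N : (Filt 𝓔 X).FullSubcategory} (e : M.obj ≅ N.obj) :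
    filtLength 𝓔 X M = filtLength 𝓔 X N :=
  le_antisymm (filtLength_le ((hasFiltration_filtLength N).of_iso e.symm))
    (filtLength_le ((hasFiltration_filtLength M).of_iso e))

lemma filtLength_le_add {A B D : (Filt 𝓔 X).FullSubcategory} {x : A.obj ⟶ B.obj}
    {y : B.obj ⟶ D.obj} {δ : Ext 𝓔.E D.obj A.obj} (h : IsTriangle 𝓔 x y δ) :
    filtLength 𝓔 X B ≤ filtLength 𝓔 X A + filtLength 𝓔 X D :=
  filtLength_le ((hasFiltration_filtLength A).extension (hasFiltration_filtLength D) h)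

lemma filtLength_of_mem (hX : IsSemibrick X) {S : (Filt 𝓔 X).FullSubcategory} (hS : X S.obj) :
    filtLength 𝓔 X S = 1 := by
  have h₁ := filtLength_le (M := S) (HasFiltration.of_mem hS)
  have h₂ := mt (filtLength_eq_zero_iff S).1 (hX.brick _ hS).not_isZero
  lia

/-- The triangle of a non-zero morphism from an object of `Filt X` to an object of `X` is
stable. -/
lemma exists_stable_of_hom_to (hX : IsSemibrick X) {M S : (Filt 𝓔 X).FullSubcategory}
    (hS : X S.obj) (f : M.obj ⟶ S.obj) (hf : f ≠ 0) :
    ∃ (K : (Filt 𝓔 X).FullSubcategory) (k : K.obj ⟶ M.obj) (δ : Ext 𝓔.E S.obj K.obj),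
      IsTriangle 𝓔 k f δ ∧ filtLength 𝓔 X M = filtLength 𝓔 X K + 1 := by
  have h₀ : filtLength 𝓔 X M ≠ 0 := fun h =>
    hf (((filtLength_eq_zero_iff M).1 h).eq_of_src _ _)
  obtain ⟨n, hn⟩ := Nat.exists_eq_succ_of_ne_zero h₀
  obtain ⟨K, k, δ, hK, h⟩ := HasFiltration.exists_triangle_of_hom_to hX
    (hn ▸ hasFiltration_filtLength M) hS f hf
  refine ⟨⟨K, n, hK⟩, k, δ, h, ?_⟩
  -- A minimal filtration of `M` bounds the length of `K` above by `n`; subadditivity bounds it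
  -- below.
  have h₁ := filtLength_le (M := ⟨K, n, hK⟩) hK
  have h₂ := filtLength_le_add (A := ⟨K, n, hK⟩) h
  rw [filtLength_of_mem hX hS] at h₂
  lia

lemma exists_stable_of_hom_from (hX : IsSemibrick X) {M S : (Filt 𝓔 X).FullSubcategory}
    (hS : X S.obj) (f : S.obj ⟶ M.obj) (hf : f ≠ 0) :
    ∃ (L : (Filt 𝓔 X).FullSubcategory) (p : M.obj ⟶ L.obj) (δ : Ext 𝓔.E L.obj S.obj),
      IsTriangle 𝓔 f p δ ∧ filtLength 𝓔 X M = filtLength 𝓔 X L + 1 := by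
  have h₀ : filtLength 𝓔 X M ≠ 0 := fun h =>
    hf (((filtLength_eq_zero_iff M).1 h).eq_of_tgt _ _)
  obtain ⟨n, hn⟩ := Nat.exists_eq_succ_of_ne_zero h₀
  obtain ⟨K, k, δ, hK, h⟩ := HasFiltration.exists_triangle_of_hom_from hX
    (hn ▸ hasFiltration_filtLength M) hS f hf
  refine ⟨⟨K, n, hK⟩, k, δ, h, ?_⟩
  have h₁ := filtLength_le (M := ⟨K, n, hK⟩) hK
  have h₂ := filtLength_le_add (D := ⟨K, n, hK⟩) h
  rw [filtLength_of_mem hX hS] at h₂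
  lia

lemma exists_mem_hom_to_ne_zero {M : (Filt 𝓔 X).FullSubcategory} (h : ¬ IsZero M.obj) :
    ∃ (S : (Filt 𝓔 X).FullSubcategory) (f : M.obj ⟶ S.obj), X S.obj ∧ f ≠ 0 := by
  obtain ⟨S, f, hS, hf⟩ := (hasFiltration_filtLength M).exists_hom_to_ne_zero h
  exact ⟨⟨S, 1, .of_mem hS⟩, f, hS, hf⟩

lemma exists_mem_hom_from_ne_zero {M : (Filt 𝓔 X).FullSubcategory} (h : ¬ IsZero M.obj) :
    ∃ (S : (Filt 𝓔 X).FullSubcategory) (f : S.obj ⟶ M.obj), X S.obj ∧ f ≠ 0 := by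
  obtain ⟨S, f, hS, hf⟩ := (hasFiltration_filtLength M).exists_hom_from_ne_zero h
  exact ⟨⟨S, 1, .of_mem hS⟩, f, hS, hf⟩

/-- Induction on the length of `D`: a non-zero morphism from `D` to an object of `X` stays non-zero
on `B`, so passing to cocones lowers both lengths by one. -/
lemma filtLength_split (hX : IsSemibrick X) {A B D : (Filt 𝓔 X).FullSubcategory}
    {x : A.obj ⟶ B.obj} {y : B.obj ⟶ D.obj} (h : IsTriangle 𝓔 x y (0 : Ext 𝓔.E D.obj A.obj)) :
    filtLength 𝓔 X B = filtLength 𝓔 X A + filtLength 𝓔 X D := by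
  refine le_antisymm (filtLength_le_add h) ?_
  induction hn : filtLength 𝓔 X D generalizing B D with
  | zero =>
    have := h.isIso_left ((filtLength_eq_zero_iff D).1 hn)
    rw [filtLength_congr (asIso x), add_zero]
  | succ n ih =>
    obtain ⟨S, f, hS, hf⟩ := exists_mem_hom_to_ne_zero (M := D)
      (fun h => by simp [(filtLength_eq_zero_iff D).2 h] at hn)
    obtain ⟨D', k, δ, hk, hl⟩ := exists_stable_of_hom_to hX hS f hf
    have hyf : y ≫ f ≠ 0 := by
      obtain ⟨s, hs⟩ := h.exists_coextend (𝟙 _) (by simp)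
      intro h₀
      apply hf
      simpa [reassoc_of% hs] using s ≫= h₀
    obtain ⟨B', q, ε, hq, hB'⟩ := exists_stable_of_hom_to hX hS (y ≫ f) hyf
    obtain ⟨N, d, e, k', δ', hδ', -, -, hN, -, -⟩ := 𝓔.et4op h hk
    -- The cocone `N` of `y ≫ f` is again a split extension, of `D'` by `A`, so the induction
    -- hypothesis applies to it.
    rw [pull_zero] at hN
    obtain ⟨i⟩ := IsTriangle.nonempty_iso_of_deflation hδ' hq
    have hN' : Filt 𝓔 X N := ⟨_, (hasFiltration_filtLength B').of_iso i.symm⟩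
    have h₁ := ih (B := ⟨N, hN'⟩) (D := D') hN (by lia)
    rw [filtLength_congr (M := ⟨N, hN'⟩) (N := B') i] at h₁
    lia

lemma filtLength_isLengthFunction (hX : IsSemibrick X) :
    IsLengthFunction 𝓔 (filtLength 𝓔 X) where
  iso_invariant _ _ := fun ⟨e⟩ => filtLength_congr e
  eq_zero_iff := filtLength_eq_zero_iff
  le_add _ _ _ h := filtLength_le_add h
  eq_add _ _ h := filtLength_split hX h

/-- A morphism of `Filt X` that is injective on morphisms from the objects of `X` is an
inflation whose triangle is stable. -/
lemma isThetaInflation_of_injective (hX : IsSemibrick X) {Z N : (Filt 𝓔 X).FullSubcategory}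
    (g : Z.obj ⟶ N.obj) (hg : ∀ S, X S → ∀ s : S ⟶ Z.obj, s ≫ g = 0 → s = 0) :
    IsThetaInflation 𝓔 (filtLength 𝓔 X) g := by
  induction hn : filtLength 𝓔 X Z generalizing Z N with
  | zero =>
    refine ⟨N, 𝟙 _, 0, IsTriangle.of_isIso_right _ _ ((filtLength_eq_zero_iff Z).1 hn), by lia⟩
  | succ n ih =>
    obtain ⟨S, i, hS, hi⟩ := exists_mem_hom_from_ne_zero (M := Z)
      (fun h => by simp [(filtLength_eq_zero_iff Z).2 h] at hn)
    obtain ⟨Z', p, δ, hp, hZ'⟩ := exists_stable_of_hom_from hX hS i hi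
    obtain ⟨N', q, ε, hq, hN'⟩ := exists_stable_of_hom_from hX hS (i ≫ g)
      (fun h => hi (hg _ hS i h))
    obtain ⟨g', hg', hδ⟩ := 𝓔.et3 hp hq (𝟙 _) g (by simp)
    rw [push_id] at hδ
    -- The induced `g'` inherits injectivity: if `t ≫ g' = 0`, then `t` lifts to `Z` because `δ` is
    -- the pullback of `ε` along `g'`, and the lift agrees with a morphism through `i`, so `t = 0`.
    obtain ⟨W, r, η, hr, hW⟩ := ih g' (by
      intro T hT t ht
      obtain ⟨t, rfl⟩ := hp.exists_coextend t (by rw [hδ, ← pull_comp, ht, zero_pull])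
      obtain ⟨k, hk⟩ := hq.exists_lift (t ≫ g) (by
        rw [Category.assoc, ← hg', ← Category.assoc, ht])
      have : t - k ≫ i = 0 := hg T hT _ (by simp [Preadditive.sub_comp, hk])
      rw [sub_eq_zero.1 this, Category.assoc, hp.comp_eq_zero, comp_zero]) (by lia)
    -- The preimage `Y` of `Z'` in `N` realizes the same class `δ` as `Z`, hence `Y ≅ Z`. However,
    -- `φ.hom ≫ j` may differ from `g` by a morphism factoring through `S`.
    obtain ⟨Y, d, e, j, η', hη', hje, hdj, hY, -, -⟩ := 𝓔.et4op hq hr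
    rw [← hδ] at hY
    obtain ⟨φ, hφ₁, hφ₂⟩ := hp.exists_iso hY
    obtain ⟨k, hk⟩ := hq.exists_lift (g - φ.hom ≫ j) (by
      rw [Preadditive.sub_comp, ← hg', Category.assoc, hje, reassoc_of% hφ₂, sub_self])
    have hik : i ≫ k = 0 := by
      by_contra h
      have := hX.isIso_of_ne_zero hS hS (i ≫ k) h
      have h₁ : (i ≫ k) ≫ i ≫ g = 0 := by
        rw [Category.assoc, hk, Preadditive.comp_sub, reassoc_of% hφ₁, hdj, sub_self]
      exact hi (hg _ hS i ((Preadditive.IsIso.comp_left_eq_zero (i ≫ k) _).1 h₁))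
    have hij : i ≫ φ.hom ≫ j = i ≫ g := by rw [reassoc_of% hφ₁, hdj]
    -- Since `i ≫ k = 0`, the correction `k ≫ i` squares to zero; this unipotent automorphism turns
    -- `φ.hom ≫ j` into `g`.
    have : IsIso (𝟙 Z.obj + k ≫ i) := isIso_of_sub_id_comp_self _ (by simp [reassoc_of% hik])
    have hgj : (asIso (𝟙 Z.obj + k ≫ i) ≪≫ φ).hom ≫ j = g := by
      simp [Preadditive.add_comp, hij, hk]
    have ht := IsTriangle.iso_comp hη' (asIso (𝟙 Z.obj + k ≫ i) ≪≫ φ)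
    rw [hgj] at ht
    exact ⟨W, _, _, ht, by lia⟩

end Filtrations

/-! ### General length functions. -/

section LengthFunctions

variable {P : ObjectProperty C} {Θ : P.FullSubcategory → ℕ}

/-- Subadditivity on the triangles ending in `K` and in `L` squeezes the length of `L` between equal
bounds, so the composite triangle is stable. -/
lemma IsThetaDeflation.comp (hP : IsExtensionClosed 𝓔 P) (hΘ : IsLengthFunction 𝓔 Θ)
    {L M N : P.FullSubcategory} {f : L.obj ⟶ M.obj} {g : M.obj ⟶ N.obj}
    (hf : IsThetaDeflation 𝓔 Θ f) (hg : IsThetaDeflation 𝓔 Θ g) :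
    IsThetaDeflation 𝓔 Θ (L := L) (M := N) (f ≫ g) := by
  obtain ⟨A, x, δ, hx, hA⟩ := hf
  obtain ⟨B, y, ε, hy, hB⟩ := hg
  obtain ⟨K, d, e, k, η, hη, -, -, hK, -, -⟩ := 𝓔.et4op hx hy
  have hPK : P K := hP.ext_mem _ _ _ hK A.property B.property
  have h₁ := hΘ.le_add (X := A) (L := ⟨K, hPK⟩) (M := B) d e _ hK
  have h₂ := hΘ.le_add (X := ⟨K, hPK⟩) (L := L) (M := N) k _ _ hη
  exact ⟨⟨K, hPK⟩, k, η, hη, by lia⟩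

lemma isThetaDeflation_id (hP : IsExtensionClosed 𝓔 P) (hΘ : IsLengthFunction 𝓔 Θ)
    (M : P.FullSubcategory) : IsThetaDeflation 𝓔 Θ (L := M) (M := M) (𝟙 M.obj) := by
  refine ⟨⟨0, hP.zero_mem _ (isZero_zero C)⟩, 0, 0,
    IsTriangle.of_isIso_right _ _ (isZero_zero C), ?_⟩
  rw [(hΘ.eq_zero_iff ⟨0, _⟩).2 (isZero_zero C), zero_add]

lemma thetaInfty_of_thetaOne {M : P.FullSubcategory} (h : thetaOne Θ M) : thetaInfty Θ M :=
  ⟨0, h⟩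

lemma thetaLevel_of_thetaOne {M : P.FullSubcategory} (h : thetaOne Θ M) (n : ℕ) :
    thetaLevel Θ n M := by
  induction n with
  | zero => exact h
  | succ n ih => exact Or.inl ih

lemma isSimple_of_eq_one (hΘ : IsLengthFunction 𝓔 Θ) {M : P.FullSubcategory} (h : Θ M = 1) :
    IsSimple 𝓔 Θ M := by
  refine ⟨fun h₀ => by simp [(hΘ.eq_zero_iff M).2 h₀] at h, ?_⟩
  rintro ⟨A, B, x, y, δ, ⟨-, hl⟩, hA, hB⟩
  have h₁ := mt (hΘ.eq_zero_iff A).1 hA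
  have h₂ := mt (hΘ.eq_zero_iff B).1 hB
  lia

end LengthFunctions

/-! ### From semibricks to length wide subcategories. -/

section FiltPair

variable {X : ObjectProperty C}

/-- Induction on the length of the intermediate object: while `b` kills some object of `X` mapping
non-trivially to `Z`, the quotient by it is absorbed into the deflation. The admissibility of a
morphism is the case `a = 𝟙`. -/
lemma isAdmissible_deflation_comp (hX : IsSemibrick X) {M Z N : (Filt 𝓔 X).FullSubcategory}
    (a : M.obj ⟶ Z.obj) (b : Z.obj ⟶ N.obj) (ha : IsThetaDeflation 𝓔 (filtLength 𝓔 X) a) :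
    IsAdmissible 𝓔 (filtLength 𝓔 X) (M := M) (N := N) (a ≫ b) := by
  induction hn : filtLength 𝓔 X Z using Nat.strong_induction_on generalizing Z with
  | h n ih =>
    by_cases hb : ∀ S, X S → ∀ s : S ⟶ Z.obj, s ≫ b = 0 → s = 0
    · exact ⟨Z, a, b, rfl, ha, isThetaInflation_of_injective hX b hb⟩
    · push Not at hb
      obtain ⟨S, hS, s, hs, hs₀⟩ := hb
      obtain ⟨Z', p, δ, hp, hZ'⟩ := exists_stable_of_hom_from (S := ⟨S, 1, .of_mem hS⟩) hX hS s hs₀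
      obtain ⟨b, rfl⟩ := hp.exists_desc b hs
      rw [← Category.assoc]
      have hS₁ := filtLength_of_mem (𝓔 := 𝓔) (S := ⟨S, 1, .of_mem hS⟩) hX hS
      exact ih (filtLength 𝓔 X Z') (by lia) (a ≫ p) b
        (ha.comp (filt_isExtensionClosed X) (filtLength_isLengthFunction hX)
          ⟨⟨S, 1, .of_mem hS⟩, s, δ, hp, by lia⟩) rfl

lemma thetaOne_filtLength_iff (hX : IsSemibrick X) (M : (Filt 𝓔 X).FullSubcategory) :
    thetaOne (filtLength 𝓔 X) M ↔ filtLength 𝓔 X M = 1 := by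
  constructor
  · rintro ⟨h₀, h⟩
    obtain ⟨S, f, hS, hf⟩ := exists_mem_hom_to_ne_zero h₀
    have h₁ := h S (hX.brick _ hS).not_isZero
    rw [filtLength_of_mem hX hS] at h₁
    have h₂ := mt (filtLength_eq_zero_iff M).1 h₀
    lia
  · intro h
    refine ⟨fun h₀ => by simp [(filtLength_eq_zero_iff M).2 h₀] at h, fun N hN => ?_⟩
    have h₂ := mt (filtLength_eq_zero_iff N).1 hN
    lia

/-- A non-zero filtered object maps non-trivially to an object of `X`, which already lies in `Θ₁`,
so it cannot enter at a later level. -/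
lemma thetaOne_of_thetaLevel_filtLength (hX : IsSemibrick X) (n : ℕ)
    (M : (Filt 𝓔 X).FullSubcategory) (h : thetaLevel (filtLength 𝓔 X) n M) :
    thetaOne (filtLength 𝓔 X) M := by
  induction n with
  | zero => exact h
  | succ n ih =>
    obtain h | ⟨h, hl⟩ := h
    · exact ih h
    · obtain ⟨S, f, hS, hf⟩ := exists_mem_hom_to_ne_zero (M := M)
        (fun h₀ => by simp [(filtLength_eq_zero_iff M).2 h₀] at hl)
      exact absurd ((h S (thetaLevel_of_thetaOne
        ((thetaOne_filtLength_iff hX S).2 (filtLength_of_mem hX hS)) n)).2 f) hf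

theorem filtPair_isLengthWide (hX : IsSemibrick X) : IsLengthWide 𝓔 (filtPair 𝓔 X) := by
  refine ⟨⟨filt_isExtensionClosed X, filtLength_isLengthFunction hX, ?_, fun M hM =>
    (thetaOne_filtLength_iff hX M).1 hM⟩, ?_⟩
  · intro M N f
    have := isAdmissible_deflation_comp hX (𝟙 _) f
      (isThetaDeflation_id (filt_isExtensionClosed X) (filtLength_isLengthFunction hX) M)
    rwa [Category.id_comp] at this
  · funext M
    exact propext ⟨thetaInfty_of_thetaOne, fun ⟨n, h⟩ => thetaOne_of_thetaLevel_filtLength hX n M h⟩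

theorem sim_filtPair (hX : IsSemibrick X) : sim 𝓔 (filtPair 𝓔 X) = X := by
  funext M
  refine propext ⟨?_, fun hM => ?_⟩
  · rintro ⟨hM, h₀, h⟩
    obtain ⟨S, f, hS, hf⟩ := exists_mem_hom_to_ne_zero (M := ⟨M, hM⟩) h₀
    obtain ⟨K, k, δ, hk, hl⟩ := exists_stable_of_hom_to hX hS f hf
    rw [← filtLength_of_mem hX hS] at hl
    -- Simplicity forces the stable triangle `K ⟶ M ⟶ S` to be degenerate, hence `M ≅ S`.
    have hK : IsZero K.obj := by
      by_contra hK
      exact h ⟨K, S, k, f, δ, ⟨hk, hl⟩, hK, (hX.brick _ hS).not_isZero⟩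
    have := hk.isIso_right hK
    exact hX.iso_closed.of_iso (asIso f).symm hS
  · exact ⟨⟨1, .of_mem hM⟩, isSimple_of_eq_one (filtLength_isLengthFunction hX)
      (filtLength_of_mem hX hM)⟩

end FiltPair

/-! ### From length wide subcategories to semibricks. -/

section LengthWide

variable {P : ObjectProperty C} {Θ : P.FullSubcategory → ℕ}

/-- Schur's lemma. -/
lemma IsLengthSubcategory.isIso_of_isSimple (h : IsLengthSubcategory 𝓔 Θ)
    {M N : P.FullSubcategory} (hM : IsSimple 𝓔 Θ M) (hN : IsSimple 𝓔 Θ N) (f : M.obj ⟶ N.obj)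
    (hf : f ≠ 0) : IsIso f := by
  obtain ⟨Z, i, j, rfl, ⟨K, k, δ, hi⟩, ⟨L, l, ε, hj⟩⟩ := h.admissible f
  have hZ : ¬ IsZero Z.obj := fun hZ => hf (by rw [hZ.eq_of_tgt i 0, zero_comp])
  have hK : IsZero K.obj := by
    by_contra hK
    exact hM.2 ⟨K, Z, k, i, δ, hi, hK, hZ⟩
  have hL : IsZero L.obj := by
    by_contra hL
    exact hN.2 ⟨Z, L, j, l, ε, hj, hZ, hL⟩
  have := hi.1.isIso_right hK
  have := hj.1.isIso_left hL
  infer_instance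

lemma IsSimple.of_iso (hΘ : IsLengthFunction 𝓔 Θ) {M N : P.FullSubcategory}
    (hM : IsSimple 𝓔 Θ M) (e : M.obj ≅ N.obj) : IsSimple 𝓔 Θ N := by
  refine ⟨fun h => hM.1 (h.of_iso e), ?_⟩
  rintro ⟨A, B, x, y, δ, ⟨h, hl⟩, hA, hB⟩
  exact hM.2 ⟨A, B, x ≫ e.inv, e.hom ≫ y, δ, ⟨h.of_iso e.symm rfl (by simp),
    by rw [hΘ.iso_invariant M N ⟨e⟩, hl]⟩, hA, hB⟩

theorem IsLengthSubcategory.sim_isSemibrick (h : IsLengthSubcategory 𝓔 Θ) :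
    IsSemibrick (sim 𝓔 ⟨P, Θ⟩) where
  iso_closed := ⟨by
    rintro M N e ⟨hM, hs⟩
    have hN := h.extensionClosed.iso_closed.of_iso e hM
    exact ⟨hN, hs.of_iso h.lengthFunction (N := ⟨N, hN⟩) e⟩⟩
  brick := by
    rintro M ⟨hM, hs⟩
    refine ⟨⟨0, 1, fun h₀ => hs.1 ((IsZero.iff_id_eq_zero M).2 h₀.symm)⟩, fun f hf => ?_⟩
    exact (isUnit_iff_isIso f).2 (h.isIso_of_isSimple hs hs f hf)
  hom_eq_zero := by
    rintro M N ⟨hM, hs⟩ ⟨hN, ht⟩ hMN f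
    by_contra hf
    have := h.isIso_of_isSimple hs ht f hf
    exact hMN ⟨asIso f⟩

/-- In a length wide subcategory the simple objects are those of length one. -/
lemma eq_one_of_isSimple (h : IsLengthSubcategory 𝓔 Θ) (hw : thetaOne Θ = thetaInfty Θ)
    {M : P.FullSubcategory} (hM : IsSimple 𝓔 Θ M) : Θ M = 1 := by
  by_contra h₁
  have h₀ := mt (h.lengthFunction.eq_zero_iff M).1 hM.1
  obtain ⟨n, hn⟩ : ∃ n, Θ M = n + 2 := ⟨Θ M - 2, by lia⟩
  have hM' : thetaInfty Θ M := by
    -- `thetaLevel` starts at `Θ₁`, so an object of length `n + 2` can enter at index `n + 1`,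
    -- tested against index `n`, all of whose objects have length one.
    refine ⟨n + 1, Or.inr ⟨fun N hN => ?_, hn⟩⟩
    have hN₁ : thetaOne Θ N := by rw [hw]; exact ⟨n, hN⟩
    have hN₂ := h.normalized N hN₁
    have hN₃ : IsSimple 𝓔 Θ N := isSimple_of_eq_one h.lengthFunction hN₂
    constructor
    · intro f
      by_contra hf
      have := h.isIso_of_isSimple hN₃ hM f hf
      exact h₁ (hN₂ ▸ (h.lengthFunction.iso_invariant N M ⟨asIso f⟩).symm)
    · intro f
      by_contra hf
      have := h.isIso_of_isSimple hM hN₃ f hf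
      exact h₁ (hN₂ ▸ h.lengthFunction.iso_invariant M N ⟨asIso f⟩)
  rw [← hw] at hM'
  exact h₁ (h.normalized M hM')

lemma hasFiltration_sim (h : IsLengthSubcategory 𝓔 Θ) (hw : thetaOne Θ = thetaInfty Θ)
    (M : P.FullSubcategory) : HasFiltration 𝓔 (sim 𝓔 ⟨P, Θ⟩) (Θ M) M.obj := by
  induction hn : Θ M using Nat.strong_induction_on generalizing M with
  | h n ih =>
    by_cases h₀ : IsZero M.obj
    · rw [← hn, (h.lengthFunction.eq_zero_iff M).2 h₀]
      exact .zero _ h₀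
    by_cases hs : IsSimple 𝓔 Θ M
    · rw [← hn, eq_one_of_isSimple h hw hs]
      exact .of_mem ⟨M.property, hs⟩
    · simp only [IsSimple, h₀, not_false_eq_true, true_and, not_not] at hs
      obtain ⟨A, B, x, y, δ, ⟨ht, hl⟩, hA, hB⟩ := hs
      have h₁ := mt (h.lengthFunction.eq_zero_iff A).1 hA
      have h₂ := mt (h.lengthFunction.eq_zero_iff B).1 hB
      rw [← hn, hl]
      exact (ih _ (by lia) A rfl).extension (ih _ (by lia) B rfl) ht

lemma exists_le_of_hasFiltration_sim (h : IsLengthSubcategory 𝓔 Θ)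
    (hw : thetaOne Θ = thetaInfty Θ) {n : ℕ} {M : C}
    (hM : HasFiltration 𝓔 (sim 𝓔 ⟨P, Θ⟩) n M) : ∃ hP : P M, Θ ⟨M, hP⟩ ≤ n := by
  induction hM with
  | zero M hM =>
    exact ⟨h.extensionClosed.zero_mem M hM, ((h.lengthFunction.eq_zero_iff _).2 hM).le⟩
  | @succ n L M S f g δ _ ht hS ih =>
    obtain ⟨hL, hl⟩ := ih
    obtain ⟨hS, hs⟩ := hS
    refine ⟨h.extensionClosed.ext_mem f g δ ht hL hS, ?_⟩
    have h₁ := h.lengthFunction.le_add (X := ⟨L, hL⟩)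
      (L := ⟨M, h.extensionClosed.ext_mem f g δ ht hL hS⟩) (M := ⟨S, hS⟩) f g δ ht
    have h₂ : Θ ⟨S, hS⟩ = 1 := eq_one_of_isSimple h hw hs
    lia

theorem filtPair_sim {W : SubcategoryWithLength C} (hW : IsLengthWide 𝓔 W) :
    filtPair 𝓔 (sim 𝓔 W) = W := by
  obtain ⟨P, Θ⟩ := W
  obtain ⟨h, hw⟩ := hW
  have hP : Filt 𝓔 (sim 𝓔 ⟨P, Θ⟩) = P := by
    funext M
    exact propext ⟨fun ⟨n, hM⟩ => (exists_le_of_hasFiltration_sim h hw hM).1,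
      fun hM => ⟨_, hasFiltration_sim h hw ⟨M, hM⟩⟩⟩
  have hl : ∀ (M : C) (h₁ : Filt 𝓔 (sim 𝓔 ⟨P, Θ⟩) M) (h₂ : P M),
      filtLength 𝓔 (sim 𝓔 ⟨P, Θ⟩) ⟨M, h₁⟩ = Θ ⟨M, h₂⟩ := fun M h₁ h₂ =>
    le_antisymm (filtLength_le (hasFiltration_sim h hw ⟨M, h₂⟩))
      (exists_le_of_hasFiltration_sim h hw (hasFiltration_filtLength ⟨M, h₁⟩)).2
  unfold filtPair
  -- The length depends on the subcategory; both become variables so that `subst` can identify the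
  -- two domains.
  generalize filtLength 𝓔 (sim 𝓔 ⟨P, Θ⟩) = l at hl ⊢
  generalize Filt 𝓔 (sim 𝓔 ⟨P, Θ⟩) = Q at hP l hl ⊢
  subst hP
  congr
  funext M
  exact hl M.obj M.property M.property

end LengthWide

end Extri

theorem theorem3 {C : Type u} [Category.{v} C] [Preadditive C] [HasZeroObject C]
    [HasBinaryBiproducts C] (hKS : Extri.IsKrullSchmidt C)
    (𝓔 : Extri.ExtriangulatedStructure.{w} C) :
    Set.BijOn (Extri.filtPair 𝓔) {X : ObjectProperty C | Extri.IsSemibrick X} {W | Extri.IsLengthWide 𝓔 W} ∧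
    Set.BijOn (Extri.sim 𝓔) {W | Extri.IsLengthWide 𝓔 W} {X : ObjectProperty C | Extri.IsSemibrick X} ∧
    Set.InvOn (Extri.sim 𝓔) (Extri.filtPair 𝓔)
      {X : ObjectProperty C | Extri.IsSemibrick X} {W | Extri.IsLengthWide 𝓔 W} := by
  have h₁ : Set.MapsTo (Extri.filtPair 𝓔) {X : ObjectProperty C | Extri.IsSemibrick X}
      {W | Extri.IsLengthWide 𝓔 W} := fun _ hX => Extri.filtPair_isLengthWide hX
  have h₂ : Set.MapsTo (Extri.sim 𝓔) {W | Extri.IsLengthWide 𝓔 W}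
      {X : ObjectProperty C | Extri.IsSemibrick X} := fun _ hW => hW.1.sim_isSemibrick
  have h₃ : Set.InvOn (Extri.sim 𝓔) (Extri.filtPair 𝓔)
      {X : ObjectProperty C | Extri.IsSemibrick X} {W | Extri.IsLengthWide 𝓔 W} :=
    ⟨fun _ hX => Extri.sim_filtPair hX, fun _ hW => Extri.filtPair_sim hW⟩
  exact ⟨h₃.bijOn h₁ h₂, h₃.symm.bijOn h₂ h₁, h₃⟩
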